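/- **Setting.** Let $\mathcal X$ be a measurable space with reference measure $\mathrm dx$, let $L\ge 2$, $[L]=\{1,\dots,L\}$, $\lambda\in(0,1)$, and let $r_i>0$ $(i\in[L])$ satisfy $\sum_{i}r_i=1$. For each $i\in[L]$ let $p_i$ be a probability density on $\mathcal X$, $P_i$ the distribution with density $p_i$, and $M_i$ a Markov transition kernel on $\mathcal X$ with stationary distribution $P_i$. The simulated tempering chain is the Markov chain on $[L]\times\mathcal X$ with the following kernel $M$: from $(i,x)$, with probability $1-\lambda$ move to $(i,x')$ with $x'\sim M_i(x,\cdot)$; with probability $\lambda$ propose $i'=i+1$ or $i'=i-1$, each with probability $1/2$, and move to $(i',x)$ with probability $a((i,x),(i',x))=\min\{r_{i'}p_{i'}(x)/(r_ip_i(x)),1\}$ (read as $1$ where $p_i(x)=0$), staying at $(i,x)$ otherwise; a proposal $i'\notin[L]$ is always rejected. Let $P$ be the distribution on $[L]\times\mathcal X$ given by $P(i,\mathrm dx)=r_iP_i(\mathrm dx)$. For a kernel $K$ on $\Omega$ with stationary distribution $\Pi$ and a measurable $\Omega^0\subseteq\Omega$ with $\Pi(\Omega^0)>0$, the restricted spectral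 gap is $$\mathrm{SpecGap}_{\Omega^0}(K)=\inf_{g}\frac{\frac12\int_{\Omega^0}\int_{\Omega^0}[g(\omega')-g(\omega)]^2\,\Pi(\mathrm d\omega)K(\omega,\mathrm d\omega')}{\frac12\int_{\Omega^0}\int_{\Omega^0}[g(\omega')-g(\omega)]^2\,\Pi(\mathrm d\omega)\Pi(\mathrm d\omega')},$$ the infimum being over all $g\in\mathcal L^2(\Omega,\Pi)$ with nonzero denominator ($\inf\emptyset=\infty$). The total variation distance is $\|\Pi_1-\Pi_2\|_{\mathrm{tv}}=\int|\pi_1-\pi_2|$, where $\pi_1,\pi_2$ are densities with respect to a common dominating measure (so it takes values in $[0,2]$ on probability measures). **Lemma.** Assume that $M$ is reversible with respect to $P$ and lazy, i.e. $M((i,x),\{(i,x)\})\ge\frac12$ for all $(i,x)$. Let the initial distribution $P^0$ be absolutely continuous with respect to $P$, with density $f_0=\mathrm dP^0/\mathrm dP$. Let $P^N$ be the distribution of the chain after $N$ steps and, for $i\in[L]$, let $P_i^N$ be the normalization of $P^N(i,\mathrm dx)$ (the zero measure if $P^N(\{i\}\times\mathcal X)=0$). Fix $\varepsilon\in(0,1)$,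 and suppose that there are constants $B>1$, $2<q\le\infty$, $C_M>0$ and a measurable set $\mathcal X^0\subseteq\mathcal X$ such that 1. $\|f_0\|_{\mathcal L^q(P)}\le B$; 2. $P([L]\times\mathcal X^0)\ge 1-\left(\frac{\varepsilon^2}{20B^2}\right)^{q/(q-2)}$ (with exponent $1$ if $q=\infty$); 3. $\mathrm{SpecGap}_{[L]\times\mathcal X^0}(M)\ge C_M^{-1}$. Then for every integer $N\ge C_M\log(2B^2/\varepsilon^2)$, $$\|P^N-P\|_{\mathrm{tv}}\le\varepsilon\qquad\text{and}\qquad\|P_i^N-P_i\|_{\mathrm{tv}}\le\frac{3\varepsilon}{2\min_{k\in[L]}r_k}\quad\text{for all }i\in[L].$$ -/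

import Mathlib

open MeasureTheory ProbabilityTheory
open scoped ENNReal

noncomputable section

/-- Restricted Dirichlet form
`½ ∫_{Ω⁰} ∫_{Ω⁰} (g ω' - g ω)² π(dω) K(ω, dω')`. -/
def restrictedDirichlet {Ω : Type*} [MeasurableSpace Ω] (K : Kernel Ω Ω) (π : Measure Ω)
    (Ω0 : Set Ω) (g : Ω → ℝ) : ℝ≥0∞ :=
  2⁻¹ * ∫⁻ ω in Ω0, ∫⁻ ω' in Ω0, ENNReal.ofReal ((g ω' - g ω) ^ 2) ∂(K ω) ∂π

/-- Restricted variance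
`½ ∫_{Ω⁰} ∫_{Ω⁰} (g ω' - g ω)² π(dω) π(dω')`. -/
def restrictedVar {Ω : Type*} [MeasurableSpace Ω] (π : Measure Ω)
    (Ω0 : Set Ω) (g : Ω → ℝ) : ℝ≥0∞ :=
  2⁻¹ * ∫⁻ ω in Ω0, ∫⁻ ω' in Ω0, ENNReal.ofReal ((g ω' - g ω) ^ 2) ∂π ∂π

/-- The `Ω⁰`-restricted spectral gap: the infimum of `ℰ_{Ω⁰}(g,g) / Var_{π,Ω⁰}(g)` over
`g ∈ L²(π)` for which the quotient makes sense, i.e. the restricted variance is nonzero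
(an infimum over no function at all is `∞`). -/
def restrictedSpecGap {Ω : Type*} [MeasurableSpace Ω] (K : Kernel Ω Ω) (π : Measure Ω)
    (Ω0 : Set Ω) : ℝ≥0∞ :=
  ⨅ (g : Ω → ℝ) (_ : MemLp g 2 π) (_ : restrictedVar π Ω0 g ≠ 0),
    restrictedDirichlet K π Ω0 g / restrictedVar π Ω0 g

/-- A kernel is lazy if it stays put with probability at least `1/2` from every state. -/
def IsLazyKernel {Ω : Type*} [MeasurableSpace Ω] (K : Kernel Ω Ω) : Prop :=
  ∀ ω, 2⁻¹ ≤ K ω {ω}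

/-- Total variation distance `∫ |π₁ - π₂|`, with values in `[0, 2]` on probability measures.
The densities are taken with respect to the common dominating measure `ν₁ + ν₂`; the value does
not depend on the choice of the dominating measure. -/
def tvDist {Ω : Type*} [MeasurableSpace Ω] (ν₁ ν₂ : Measure Ω) : ℝ :=
  ∫ ω, |(ν₁.rnDeriv (ν₁ + ν₂) ω).toReal - (ν₂.rnDeriv (ν₁ + ν₂) ω).toReal| ∂(ν₁ + ν₂)

/-- The law after `N` steps of the chain with transition kernel `K` and initial law `ν`. -/
def lawAfter {Ω : Type*} [MeasurableSpace Ω] (K : Kernel Ω Ω) (ν : Measure Ω) (N : ℕ) :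
    Measure Ω :=
  (fun ρ : Measure Ω => ρ.bind K)^[N] ν

/-- The conditional law of the second coordinate given that the first one is `i`, i.e. the
normalization of `ν(i, dx)`. (It is the zero measure if `ν({i} × 𝒳) = 0`.) -/
def condLevel {L : ℕ} {X : Type*} [MeasurableSpace X] (ν : Measure (Fin L × X)) (i : Fin L) :
    Measure X :=
  (ProbabilityTheory.cond ν (Prod.fst ⁻¹' {i})).map Prod.snd

/-- The exponent `q / (q - 2)` for `2 < q ≤ ∞`, equal to `1` for `q = ∞`. -/
def tailExponent (q : ℝ≥0∞) : ℝ :=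
  if q = ∞ then 1 else q.toReal / (q.toReal - 2)

/-- The data of a simulated tempering chain on `[L] × 𝒳`; densities are with respect to the
reference measure `μ` on `𝒳`. -/
structure SimulatedTempering (L : ℕ) {X : Type*} [MeasurableSpace X] (μ : Measure X) where
  /-- there are at least two temperature levels -/
  two_le : 2 ≤ L
  /-- probability of attempting a temperature swap -/
  lam : ℝ
  lam_pos : 0 < lam
  lam_lt_one : lam < 1
  /-- weights of the levels -/
  r : Fin L → ℝ
  r_pos : ∀ i, 0 < r i
  r_sum : ∑ i, r i = 1
  /-- stationary densities at the levels -/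
  p : Fin L → X → ℝ
  p_measurable : ∀ i, Measurable (p i)
  p_nonneg : ∀ i x, 0 ≤ p i x
  p_lintegral : ∀ i, ∫⁻ x, ENNReal.ofReal (p i x) ∂μ = 1
  /-- transition kernels at the levels -/
  K : Fin L → Kernel X X
  K_markov : ∀ i, IsMarkovKernel (K i)
  K_invariant : ∀ i, (K i).Invariant (μ.withDensity fun x => ENNReal.ofReal (p i x))

namespace SimulatedTempering

variable {L : ℕ} {X : Type*} [MeasurableSpace X] {μ : Measure X}

/-- The distribution `P_i` with density `p_i`. -/
def levelLaw (S : SimulatedTempering L μ) (i : Fin L) : Measure X :=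
  μ.withDensity fun x => ENNReal.ofReal (S.p i x)

/-- The distribution `P` on `[L] × 𝒳` with density `p(i, x) = r_i p_i(x)`, that is
`P(i, dx) = r_i P_i(dx)`. -/
def law (S : SimulatedTempering L μ) : Measure (Fin L × X) :=
  ∑ i, ENNReal.ofReal (S.r i) • (S.levelLaw i).map (Prod.mk i)

/-- Acceptance probability `min {r_{i'} p_{i'}(x) / (r_i p_i(x)), 1}` of the swap from `(i, x)` to
`(i', x)`, with the usual Metropolis convention that it is `1` where `r_i p_i(x) = 0`. -/
def accept (S : SimulatedTempering L μ) (i i' : Fin L) (x : X) : ℝ :=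
  if S.r i * S.p i x = 0 then 1 else min (S.r i' * S.p i' x / (S.r i * S.p i x)) 1

/-- Probability of moving from `(i, x)` to `(i', x)` by an accepted swap:
`(λ/2) a((i,x),(i',x))` if `i' = i ± 1`, and `0` otherwise. -/
def swapProb (S : SimulatedTempering L μ) (i i' : Fin L) (x : X) : ℝ :=
  if (i' : ℕ) = i + 1 ∨ (i : ℕ) = i' + 1 then S.lam / 2 * S.accept i i' x else 0

theorem measurable_swapProb (S : SimulatedTempering L μ) (i i' : Fin L) :
    Measurable (S.swapProb i i') := by
  have h1 := S.p_measurable i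
  have h2 := S.p_measurable i'
  unfold swapProb
  split_ifs
  · refine Measurable.const_mul (Measurable.ite ?_ measurable_const ?_) _
    · exact (h1.const_mul _) (measurableSet_singleton 0)
    · exact ((h2.const_mul _).div (h1.const_mul _)).min measurable_const
  · exact measurable_const

/-- The simulated tempering transition kernel. From `(i, x)`: with probability `1 - λ` the second
coordinate moves according to `M_i`; with probability `λ` a swap to `i ± 1` (each with probability
`1/2`) is proposed, and the chain stays at `(i, x)` if the proposal is rejected or leaves `[L]`. -/
def kernel (S : SimulatedTempering L μ) : Kernel (Fin L × X) (Fin L × X) where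
  toFun ω :=
    ENNReal.ofReal (1 - S.lam) • (S.K ω.1 ω.2).map (Prod.mk ω.1)
      + ∑ i', ENNReal.ofReal (S.swapProb ω.1 i' ω.2) • Measure.dirac (i', ω.2)
      + ENNReal.ofReal (S.lam - ∑ i', S.swapProb ω.1 i' ω.2) • Measure.dirac ω
  measurable' := by
    refine measurable_from_prod_countable_right fun i => ?_
    refine Measure.measurable_of_measurable_coe _ fun s hs => ?_
    have hd : ∀ j : Fin L, Measurable fun x : X => Measure.dirac (j, x) s := fun j =>
      (Measure.measurable_coe hs).comp (Measure.measurable_dirac.comp measurable_prodMk_left)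
    have hw := fun j => S.measurable_swapProb i j
    simp only [Measure.add_apply, Measure.smul_apply, Measure.finsetSum_apply, smul_eq_mul]
    refine ((Measurable.const_mul ?_ _).add (Finset.measurable_sum _ fun j _ =>
      (hw j).ennreal_ofReal.mul (hd j))).add (Measurable.mul ?_ (hd i))
    · have : (fun x : X => (S.K i x).map (Prod.mk i) s)
          = fun x => S.K i x (Prod.mk i ⁻¹' s) := by
        funext x
        exact Measure.map_apply measurable_prodMk_left hs
      rw [this]
      exact Kernel.measurable_coe _ (measurable_prodMk_left hs)
    · exact (measurable_const.sub (Finset.measurable_sum _ fun j _ => hw j)).ennreal_ofReal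

end SimulatedTempering

end

/-! Write `f n` for the density of the law after n steps with respect to the stationary law π.
Reversibility gives `f (n + 1) = markovOp K (f n)`, and the total variation distance to π is ∫|f n −
1|, at most the square root of the variance V n = ∫(f n)² − 1. So it suffices to make V small.

Laziness makes 2K − I a Markov operator, hence ‖Kf‖² ≤ ⟨f, Kf⟩: one step lowers ‖f‖² by at least the
Dirichlet form (`integral_markovOp_sq_le`). That form dominates its restriction to s = [L] × X0, and
so the restricted gap c times the restricted variance (`integral_markovOp_sq_le_sub`). Since K
contracts L^q, the bound B persists for all n, and Hölder shows that the part of f outside s costs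
only a = 2B²η, where η = ε²/(20B²) (`sub_le_restrictedVar`). Hence V (n+1) ≤ V n − c (V n − a)₊, so
V decays exponentially down to the tolerance a (`integral_sq_sub_one_le`).

For a single level, normalizing adds the error in the level's mass. That error is at most half the
total variation distance, which yields the factor 3/2 (`tvDist_condLevel_le`). -/

theorem integral_sub_add {α : Type*} [MeasurableSpace α] {ν : Measure α} {u v w : α → ℝ}
    (hu : Integrable u ν) (hv : Integrable v ν) (hw : Integrable w ν) :
    ∫ x, (u x - v x + w x) ∂ν = ∫ x, u x ∂ν - ∫ x, v x ∂ν + ∫ x, w x ∂ν := by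
  rw [← integral_sub hu hv]
  exact integral_add (hu.sub hv) hw

theorem integral_sub_const_sq {α : Type*} [MeasurableSpace α] {ν : Measure α} [IsFiniteMeasure ν]
    {f : α → ℝ} (hf : MemLp f 2 ν) (c : ℝ) :
    ∫ x, (f x - c) ^ 2 ∂ν = ∫ x, f x ^ 2 ∂ν - 2 * c * ∫ x, f x ∂ν + ν.real Set.univ * c ^ 2 := by
  have hf1 : Integrable f ν := hf.integrable one_le_two
  have he : (fun x => (f x - c) ^ 2) = fun x => f x ^ 2 - 2 * c * f x + c ^ 2 := by
    funext x; ring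
  rw [he, integral_sub_add hf.integrable_sq (hf1.const_mul _) (integrable_const _),
    integral_const_mul]
  simp

theorem ofReal_inv_two : ENNReal.ofReal 2⁻¹ = 2⁻¹ := by
  rw [ENNReal.ofReal_inv_of_pos two_pos]; simp

/-! ### Markov operators of lazy and reversible kernels. -/

section LazyReversible

variable {Ω : Type*} [MeasurableSpace Ω] {K : Kernel Ω Ω} {π : Measure Ω}

/-- The Markov operator `f ↦ ∫ f dK(ω, ·)` on real functions. -/
noncomputable def markovOp (K : Kernel Ω Ω) (f : Ω → ℝ) (ω : Ω) : ℝ := ∫ ω', f ω' ∂(K ω)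

theorem measurable_markovOp {f : Ω → ℝ} (hf : Measurable f) : Measurable (markovOp K f) :=
  (hf.stronglyMeasurable.integral_kernel (κ := K)).measurable

theorem markovOp_nonneg {f : Ω → ℝ} (hf : ∀ ω, 0 ≤ f ω) (ω : Ω) : 0 ≤ markovOp K f ω :=
  integral_nonneg hf

theorem lintegral_lintegral_of_invariant (hinv : K.Invariant π) {g : Ω → ℝ≥0∞}
    (hg : Measurable g) : ∫⁻ ω, ∫⁻ ω', g ω' ∂(K ω) ∂π = ∫⁻ ω, g ω ∂π := by
  conv_rhs => rw [← hinv.def]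
  exact (Measure.lintegral_bind K.aemeasurable hg.aemeasurable).symm

/-- π is the π-mixture of the measures K ω. Where integrability under K ω fails, `markovOp` takes
the default value 0, so the pointwise identities below hold only almost everywhere. -/
theorem ae_integrable_of_invariant (hinv : K.Invariant π) {f : Ω → ℝ} (hf : Integrable f π) :
    ∀ᵐ ω ∂π, Integrable f (K ω) := by
  rw [← hinv.def] at hf
  exact Measure.ae_integrable_of_integrable_comp hf

theorem integrable_markovOp (hinv : K.Invariant π) {f : Ω → ℝ} (hf : Integrable f π) :
    Integrable (markovOp K f) π := by
  have h : Integrable f ((K ∘ₖ Kernel.const Unit π) ()) := by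
    rwa [Kernel.comp_const, hinv.def]
  exact h.integral_comp

theorem integral_markovOp (hinv : K.Invariant π) {f : Ω → ℝ} (hf : Integrable f π) :
    ∫ ω, markovOp K f ω ∂π = ∫ ω, f ω ∂π := by
  have h : Integrable f ((K ∘ₖ Kernel.const Unit π) ()) := by
    rwa [Kernel.comp_const, hinv.def]
  have := Kernel.integral_comp h
  rw [Kernel.comp_const, hinv.def] at this
  exact this.symm

theorem ae_memLp_two_of_invariant (hinv : K.Invariant π) {f : Ω → ℝ} (hfm : Measurable f)
    (hf : MemLp f 2 π) : ∀ᵐ ω ∂π, MemLp f 2 (K ω) := by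
  filter_upwards [ae_integrable_of_invariant hinv hf.integrable_sq] with ω hω
  exact (memLp_two_iff_integrable_sq hfm.aestronglyMeasurable).2 hω

/-- The Markov operator of a kernel contracts every `L^q` norm of an invariant law. -/
theorem eLpNorm_markovOp_le [IsMarkovKernel K] (hinv : K.Invariant π) {f : Ω → ℝ}
    (hf : Measurable f) {q : ℝ≥0∞} (hq : 1 ≤ q) :
    eLpNorm (markovOp K f) q π ≤ eLpNorm f q π := by
  -- Jensen under the probability measure K ω; averaging over the invariant law then gives the
  -- contraction.
  have hpt : ∀ ω, ‖markovOp K f ω‖ₑ ≤ eLpNorm f q (K ω) := fun ω =>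
    (enorm_integral_le_lintegral_enorm _).trans (by
      rw [← eLpNorm_one_eq_lintegral_enorm]
      exact eLpNorm_le_eLpNorm_of_exponent_le hq hf.aestronglyMeasurable)
  rcases eq_or_ne q ∞ with rfl | hq'
  · have h1 : ∀ᵐ ω ∂π, ‖f ω‖ₑ ≤ eLpNorm f ∞ π := by
      simpa [eLpNorm_exponent_top] using ae_le_eLpNormEssSup
    rw [← hinv.def] at h1
    have h2 := Measure.ae_ae_of_ae_bind K.aemeasurable h1
    rw [hinv.def] at h2
    rw [eLpNorm_exponent_top]
    refine essSup_le_of_ae_le _ ?_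
    filter_upwards [h2] with ω hω
    refine (hpt ω).trans ?_
    rw [eLpNorm_exponent_top]
    exact essSup_le_of_ae_le _ hω
  · have hq0 : q ≠ 0 := (zero_lt_one.trans_le hq).ne'
    have hqr : 0 < q.toReal := ENNReal.toReal_pos hq0 hq'
    simp only [eLpNorm_eq_lintegral_rpow_enorm_toReal hq0 hq'] at hpt ⊢
    refine ENNReal.rpow_le_rpow ?_ (by positivity)
    rw [← lintegral_lintegral_of_invariant hinv (hf.enorm.pow_const q.toReal)]
    refine lintegral_mono fun ω => ?_
    calc ‖markovOp K f ω‖ₑ ^ q.toReal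
        ≤ ((∫⁻ x, ‖f x‖ₑ ^ q.toReal ∂(K ω)) ^ (1 / q.toReal)) ^ q.toReal :=
          ENNReal.rpow_le_rpow (hpt ω) hqr.le
      _ = ∫⁻ x, ‖f x‖ₑ ^ q.toReal ∂(K ω) := by
          rw [← ENNReal.rpow_mul, one_div_mul_cancel hqr.ne', ENNReal.rpow_one]

theorem memLp_markovOp [IsMarkovKernel K] (hinv : K.Invariant π) {f : Ω → ℝ}
    (hfm : Measurable f) {q : ℝ≥0∞} (hq : 1 ≤ q) (hf : MemLp f q π) :
    MemLp (markovOp K f) q π :=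
  ⟨(measurable_markovOp hfm).aestronglyMeasurable,
    (eLpNorm_markovOp_le hinv hfm hq).trans_lt hf.2⟩

/-- K ω dominates half a Dirac mass at ω; laziness enters the decay argument only here. The
comparison is made on measurable sets containing ω, so singletons need not be measurable. -/
theorem half_mul_le_lintegral_of_lazy (hlazy : IsLazyKernel K) {g : Ω → ℝ≥0∞}
    (hg : Measurable g) (ω : Ω) : 2⁻¹ * g ω ≤ ∫⁻ ω', g ω' ∂(K ω) := by
  have h : (2⁻¹ : ℝ≥0∞) • Measure.dirac ω ≤ K ω := by
    refine Measure.le_iff.2 fun s hs => ?_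
    rw [Measure.smul_apply, Measure.dirac_apply' _ hs, smul_eq_mul]
    by_cases hω : ω ∈ s
    · simpa [hω] using (hlazy ω).trans (measure_mono (Set.singleton_subset_iff.2 hω))
    · simp [hω]
  calc 2⁻¹ * g ω = ∫⁻ ω', g ω' ∂((2⁻¹ : ℝ≥0∞) • Measure.dirac ω) := by
        rw [lintegral_smul_measure, lintegral_dirac' _ hg, smul_eq_mul]
    _ ≤ _ := lintegral_mono' h le_rfl

/-- Jensen's inequality for the kernel `2K - I`, a Markov kernel when `K` is lazy. -/
theorem two_mul_markovOp_sub_sq_le [IsMarkovKernel K] (hlazy : IsLazyKernel K) {f : Ω → ℝ}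
    (hfm : Measurable f) {ω : Ω} (hf : MemLp f 2 (K ω)) :
    (2 * markovOp K f ω - f ω) ^ 2 ≤ 2 * markovOp K (fun x => f x ^ 2) ω - f ω ^ 2 := by
  have key : ∀ c : ℝ, 2⁻¹ * (f ω - c) ^ 2
      ≤ markovOp K (fun x => f x ^ 2) ω - 2 * c * markovOp K f ω + c ^ 2 := by
    intro c
    have hi : Integrable (fun x => (f x - c) ^ 2) (K ω) := (hf.sub (memLp_const c)).integrable_sq
    have h := half_mul_le_lintegral_of_lazy hlazy
      (g := fun x => ENNReal.ofReal ((f x - c) ^ 2)) (by fun_prop) ω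
    rw [← ofReal_integral_eq_lintegral_ofReal hi (ae_of_all _ fun _ => sq_nonneg _)] at h
    rw [← ofReal_inv_two, ← ENNReal.ofReal_mul (by norm_num),
      ENNReal.ofReal_le_ofReal_iff (integral_nonneg fun _ => sq_nonneg _)] at h
    refine h.trans_eq ?_
    rw [integral_sub_const_sq hf]
    simp [markovOp]
  -- This c is the mean of f under (2K − I)(ω, ·), the choice for which `key` says that the variance
  -- under that measure is nonnegative.
  have := key (2 * markovOp K f ω - f ω)
  nlinarith

/-- For a lazy kernel `K ≥ 0` as an operator, so that `K² ≤ K` in the quadratic form sense. -/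
theorem integral_markovOp_sq_le [IsMarkovKernel K] [IsProbabilityMeasure π]
    (hinv : K.Invariant π) (hlazy : IsLazyKernel K) {f : Ω → ℝ}
    (hfm : Measurable f) (hf : MemLp f 2 π) :
    ∫ ω, markovOp K f ω ^ 2 ∂π ≤ ∫ ω, f ω * markovOp K f ω ∂π := by
  have hT := memLp_markovOp hinv hfm one_le_two hf
  have hsq := hf.integrable_sq
  have hTi := integrable_markovOp hinv hsq
  have hfT : Integrable (fun ω => f ω * markovOp K f ω) π := hf.integrable_mul hT
  have hle : ∫ ω, (2 * markovOp K f ω - f ω) ^ 2 ∂π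
      ≤ ∫ ω, (2 * markovOp K (fun x => f x ^ 2) ω - f ω ^ 2) ∂π := by
    refine integral_mono_of_nonneg (ae_of_all _ fun _ => sq_nonneg _)
      ((hTi.const_mul 2).sub hsq) ?_
    filter_upwards [ae_memLp_two_of_invariant hinv hfm hf] with ω hω
    exact two_mul_markovOp_sub_sq_le hlazy hfm hω
  have he : (fun ω => (2 * markovOp K f ω - f ω) ^ 2)
      = fun ω => 4 * markovOp K f ω ^ 2 - 4 * (f ω * markovOp K f ω) + f ω ^ 2 := by
    funext ω; ring
  rw [he, integral_sub_add (hT.integrable_sq.const_mul 4) (hfT.const_mul 4) hsq,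
    integral_const_mul,
    integral_const_mul, integral_sub (hTi.const_mul 2) hsq, integral_const_mul,
    integral_markovOp hinv hsq] at hle
  linarith

/-- The Dirichlet form is `⟨f, (I - K) f⟩`. -/
theorem restrictedDirichlet_univ [IsMarkovKernel K] [IsProbabilityMeasure π]
    (hinv : K.Invariant π) {f : Ω → ℝ} (hfm : Measurable f) (hf : MemLp f 2 π) :
    restrictedDirichlet K π Set.univ f
      = ENNReal.ofReal (∫ ω, f ω ^ 2 ∂π - ∫ ω, f ω * markovOp K f ω ∂π) := by
  have hT := memLp_markovOp hinv hfm one_le_two hf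
  have hsq := hf.integrable_sq
  have hTi := integrable_markovOp hinv hsq
  have hfT : Integrable (fun ω => f ω * markovOp K f ω) π := hf.integrable_mul hT
  have hin : ∀ᵐ ω ∂π, ∫⁻ ω', ENNReal.ofReal ((f ω' - f ω) ^ 2) ∂(K ω) = ENNReal.ofReal
        (markovOp K (fun x => f x ^ 2) ω - 2 * (f ω * markovOp K f ω) + f ω ^ 2)
      ∧ 0 ≤ markovOp K (fun x => f x ^ 2) ω - 2 * (f ω * markovOp K f ω) + f ω ^ 2 := by
    filter_upwards [ae_memLp_two_of_invariant hinv hfm hf] with ω hω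
    have hi : Integrable (fun x => (f x - f ω) ^ 2) (K ω) :=
      (hω.sub (memLp_const (f ω))).integrable_sq
    have he : ∫ x, (f x - f ω) ^ 2 ∂(K ω)
        = markovOp K (fun x => f x ^ 2) ω - 2 * (f ω * markovOp K f ω) + f ω ^ 2 := by
      rw [integral_sub_const_sq hω]
      simp [markovOp, mul_assoc]
    rw [← he]
    exact ⟨(ofReal_integral_eq_lintegral_ofReal hi (ae_of_all _ fun _ => sq_nonneg _)).symm,
      integral_nonneg fun _ => sq_nonneg _⟩
  rw [restrictedDirichlet]
  simp only [Measure.restrict_univ]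
  have hint : Integrable (fun ω => markovOp K (fun x => f x ^ 2) ω
      - 2 * (f ω * markovOp K f ω) + f ω ^ 2) π := (hTi.sub (hfT.const_mul 2)).add hsq
  rw [lintegral_congr_ae (hin.mono fun _ h => h.1),
    ← ofReal_integral_eq_lintegral_ofReal hint (hin.mono fun _ h => h.2),
    integral_sub_add hTi (hfT.const_mul 2) hsq, integral_const_mul, integral_markovOp hinv hsq]
  rw [← ofReal_inv_two, ← ENNReal.ofReal_mul (by norm_num)]
  congr 1
  ring

theorem restrictedDirichlet_mono {s t : Set Ω} (hst : s ⊆ t) (f : Ω → ℝ) :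
    restrictedDirichlet K π s f ≤ restrictedDirichlet K π t f := by
  unfold restrictedDirichlet
  gcongr

/-- The restricted variance is `π(s) ∫_s f² - (∫_s f)²`. -/
theorem restrictedVar_eq [IsProbabilityMeasure π] (s : Set Ω) {f : Ω → ℝ} (hf : MemLp f 2 π) :
    restrictedVar π s f
      = ENNReal.ofReal (π.real s * ∫ ω in s, f ω ^ 2 ∂π - (∫ ω in s, f ω ∂π) ^ 2) := by
  have hω : MemLp f 2 (π.restrict s) := hf.restrict s
  have hsq := hω.integrable_sq
  have hf1 : Integrable f (π.restrict s) := hω.integrable one_le_two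
  rw [restrictedVar]
  have hin : ∀ ω, ∫⁻ ω' in s, ENNReal.ofReal ((f ω' - f ω) ^ 2) ∂π = ENNReal.ofReal
        (∫ x in s, f x ^ 2 ∂π - 2 * (∫ x in s, f x ∂π) * f ω + π.real s * f ω ^ 2)
      ∧ 0 ≤ ∫ x in s, f x ^ 2 ∂π - 2 * (∫ x in s, f x ∂π) * f ω + π.real s * f ω ^ 2 := by
    intro ω
    have he : ∫ x in s, (f x - f ω) ^ 2 ∂π
        = ∫ x in s, f x ^ 2 ∂π - 2 * (∫ x in s, f x ∂π) * f ω + π.real s * f ω ^ 2 := by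
      rw [integral_sub_const_sq hω]
      simp
      ring
    have hi : Integrable (fun x => (f x - f ω) ^ 2) (π.restrict s) :=
      (hω.sub (memLp_const (f ω))).integrable_sq
    rw [← he]
    exact ⟨(ofReal_integral_eq_lintegral_ofReal hi (ae_of_all _ fun _ => sq_nonneg _)).symm,
      integral_nonneg fun _ => sq_nonneg _⟩
  have hint : Integrable (fun ω => ∫ x in s, f x ^ 2 ∂π - 2 * (∫ x in s, f x ∂π) * f ω
      + π.real s * f ω ^ 2) (π.restrict s) :=
    ((integrable_const _).sub (hf1.const_mul _)).add (hsq.const_mul _)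
  rw [lintegral_congr fun ω => (hin ω).1,
    ← ofReal_integral_eq_lintegral_ofReal hint (ae_of_all _ fun ω => (hin ω).2),
    integral_sub_add (integrable_const _) (hf1.const_mul _) (hsq.const_mul _),
    integral_const_mul, integral_const_mul, ← ofReal_inv_two, ← ENNReal.ofReal_mul (by norm_num)]
  congr 1
  simp
  ring

/-- One step of a lazy chain decreases the second moment of the density by at least the
restricted gap times the restricted variance. -/
theorem integral_markovOp_sq_le_sub [IsMarkovKernel K] [IsProbabilityMeasure π]
    (hinv : K.Invariant π) (hlazy : IsLazyKernel K) {s : Set Ω} {c : ℝ} (hc : 0 ≤ c)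
    (hgap : ENNReal.ofReal c ≤ restrictedSpecGap K π s) {f : Ω → ℝ}
    (hfm : Measurable f) (hf : MemLp f 2 π) :
    ∫ ω, markovOp K f ω ^ 2 ∂π ≤ ∫ ω, f ω ^ 2 ∂π
      - c * max (π.real s * ∫ ω in s, f ω ^ 2 ∂π - (∫ ω in s, f ω ∂π) ^ 2) 0 := by
  have h1 := integral_markovOp_sq_le hinv hlazy hfm hf
  -- Nonnegativity of the Dirichlet form, from ‖f − Kf‖² ≥ 0 and ‖Kf‖² ≤ ⟨f, Kf⟩; it allows
  -- `ENNReal.ofReal` to be cancelled below.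
  have hnn : 0 ≤ ∫ ω, f ω ^ 2 ∂π - ∫ ω, f ω * markovOp K f ω ∂π := by
    have hT := memLp_markovOp hinv hfm one_le_two hf
    have hfT : Integrable (fun ω => f ω * markovOp K f ω) π := hf.integrable_mul hT
    have h := integral_nonneg (μ := π) (f := fun ω => (f ω - markovOp K f ω) ^ 2)
      fun _ => sq_nonneg _
    have he : (fun ω => (f ω - markovOp K f ω) ^ 2)
        = fun ω => f ω ^ 2 - 2 * (f ω * markovOp K f ω) + markovOp K f ω ^ 2 := by
      funext ω; ring
    rw [he, integral_sub_add hf.integrable_sq (hfT.const_mul 2) hT.integrable_sq,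
      integral_const_mul] at h
    linarith
  have h2 : ENNReal.ofReal c * restrictedVar π s f ≤ restrictedDirichlet K π s f := by
    -- A function of zero restricted variance is not a competitor in the infimum, but the bound is
    -- trivial for it.
    by_cases h0 : restrictedVar π s f = 0
    · simp [h0]
    · refine ENNReal.mul_le_of_le_div (hgap.trans ?_)
      exact (iInf_le _ f).trans ((iInf_le _ hf).trans (iInf_le _ h0))
  have h3 := h2.trans (restrictedDirichlet_mono (Set.subset_univ s) f)
  rw [restrictedDirichlet_univ hinv hfm hf, restrictedVar_eq s hf, ← ENNReal.ofReal_mul hc,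
    ENNReal.ofReal_le_ofReal_iff hnn] at h3
  rcases le_total (π.real s * ∫ ω in s, f ω ^ 2 ∂π - (∫ ω in s, f ω ∂π) ^ 2) 0 with h | h
  · rw [max_eq_right h]; linarith
  · rw [max_eq_left h]; linarith

/-- A reversible kernel moves a law of density `F` to a law of density `K F`. -/
theorem withDensity_bind_of_reversible [IsMarkovKernel K] (hrev : K.IsReversible π)
    {F : Ω → ℝ≥0∞} (hF : Measurable F) :
    (π.withDensity F).bind K = π.withDensity fun ω => ∫⁻ ω', F ω' ∂(K ω) := by
  ext A hA
  have hKA : Measurable fun ω => K ω A := K.measurable_coe hA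
  rw [Measure.bind_apply hA K.aemeasurable, withDensity_apply _ hA,
    lintegral_withDensity_eq_lintegral_mul _ hF hKA]
  -- Both sides are additive and monotone-continuous in F; for an indicator of B the identity is
  -- reversibility for the pair A, B.
  refine Measurable.ennreal_induction (motive := fun F : Ω → ℝ≥0∞ =>
    ∫⁻ ω, (F * fun ω => K ω A) ω ∂π = ∫⁻ ω in A, ∫⁻ ω', F ω' ∂(K ω) ∂π) ?_ ?_ ?_ hF
  · intro c B hB
    simp only [lintegral_indicator_const hB]
    rw [lintegral_const_mul _ (K.measurable_coe hB), hrev hA hB,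
      ← lintegral_const_mul _ hKA, ← lintegral_indicator hB]
    refine lintegral_congr fun ω => ?_
    by_cases hω : ω ∈ B <;> simp [hω]
  · intro F G _ hF hG ihF ihG
    simp only [Pi.add_apply, lintegral_add_left hF, Pi.mul_apply, add_mul] at ihF ihG ⊢
    rw [lintegral_add_left (f := fun ω => F ω * K ω A) (hF.mul hKA), lintegral_add_left hF.lintegral_kernel, ihF, ihG]
  · intro F hF hmono ih
    simp only [Pi.mul_apply, lintegral_iSup hF hmono, ENNReal.iSup_mul] at ih ⊢
    rw [lintegral_iSup (f := fun n ω => F n ω * K ω A) (fun n => (hF n).mul hKA), lintegral_iSup]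
    · exact iSup_congr ih
    · exact fun n => (hF n).lintegral_kernel
    · exact fun m n hmn ω => lintegral_mono (hmono hmn)
    · exact fun m n hmn ω => mul_le_mul_left (hmono hmn ω) _

theorem withDensity_ofReal_bind_of_reversible [IsMarkovKernel K] (hrev : K.IsReversible π)
    {f : Ω → ℝ} (hfm : Measurable f) (hnn : ∀ ω, 0 ≤ f ω) (hf : Integrable f π) :
    (π.withDensity fun ω => ENNReal.ofReal (f ω)).bind K
      = π.withDensity fun ω => ENNReal.ofReal (markovOp K f ω) := by
  rw [withDensity_bind_of_reversible hrev hfm.ennreal_ofReal]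
  refine withDensity_congr_ae ?_
  filter_upwards [ae_integrable_of_invariant hrev.invariant hf] with ω hω
  exact (ofReal_integral_eq_lintegral_ofReal hω (ae_of_all _ hnn)).symm

theorem lawAfter_zero (ν : Measure Ω) : lawAfter K ν 0 = ν := rfl

theorem lawAfter_succ (ν : Measure Ω) (n : ℕ) :
    lawAfter K ν (n + 1) = (lawAfter K ν n).bind K :=
  Function.iterate_succ_apply' _ _ _

/-- The density of the law after `n` steps of a reversible chain is the `n`-th iterate of the
Markov operator on the initial density. -/
theorem lawAfter_withDensity [IsMarkovKernel K] (hrev : K.IsReversible π)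
    {f : ℕ → Ω → ℝ} (hfm : ∀ n, Measurable (f n)) (hnn : ∀ n ω, 0 ≤ f n ω)
    (hf : ∀ n, Integrable (f n) π) (hsucc : ∀ n, f (n + 1) = markovOp K (f n)) (n : ℕ) :
    lawAfter K (π.withDensity fun ω => ENNReal.ofReal (f 0 ω)) n
      = π.withDensity fun ω => ENNReal.ofReal (f n ω) := by
  induction n with
  | zero => exact lawAfter_zero _
  | succ n ih =>
    rw [lawAfter_succ, ih, withDensity_ofReal_bind_of_reversible hrev (hfm n) (hnn n) (hf n),
      hsucc n]

end LazyReversible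

/-! ### Decay of the variance of the density, and total variation. -/

section VarianceDecay

variable {Ω : Type*} [MeasurableSpace Ω] {K : Kernel Ω Ω} {π : Measure Ω}

/-- Hölder turns the mass of a small set into its power 1 − 2/q when bounding a second moment;
`tailExponent` is the reciprocal power. At q = ∞ this relies on `∞.toReal = 0` and `1 / 0 = 0`. -/
theorem tailExponent_mul {q : ℝ≥0∞} (hq : 2 < q) :
    tailExponent q * (2 * (1 / 2 - 1 / q.toReal)) = 1 := by
  unfold tailExponent
  split_ifs with h
  · simp [h]
  · have h2 : 2 < q.toReal := by
      simpa using (ENNReal.toReal_lt_toReal ENNReal.ofNat_ne_top h).2 hq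
    have h3 : q.toReal - 2 ≠ 0 := by linarith
    have h4 : q.toReal ≠ 0 := by linarith
    field_simp

theorem one_le_tailExponent {q : ℝ≥0∞} (hq : 2 < q) : 1 ≤ tailExponent q := by
  unfold tailExponent
  split_ifs with h
  · exact le_rfl
  · have h2 : 2 < q.toReal := by
      simpa using (ENNReal.toReal_lt_toReal ENNReal.ofNat_ne_top h).2 hq
    rw [le_div_iff₀ (by linarith)]
    linarith

/-- Hölder's inequality: an `L^q`-bounded function has small second moment on a small set. -/
theorem setIntegral_sq_le [IsProbabilityMeasure π] {f : Ω → ℝ} (hf : MemLp f 2 π) {q : ℝ≥0∞}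
    (hq : 2 < q) {B : ℝ} (hB : 0 ≤ B) (hfB : eLpNorm f q π ≤ ENNReal.ofReal B) {A : Set Ω}
    {η : ℝ} (hη : 0 ≤ η) (hA : π.real A ≤ η ^ tailExponent q) :
    ∫ ω in A, f ω ^ 2 ∂π ≤ B ^ 2 * η := by
  set e : ℝ := 1 / 2 - 1 / q.toReal with he
  have hte : tailExponent q * (2 * e) = 1 := tailExponent_mul hq
  have he0 : 0 ≤ e := by
    have := one_le_tailExponent hq
    by_contra h
    nlinarith
  have hfA : MemLp f 2 (π.restrict A) := hf.restrict A
  have h1 := eLpNorm_le_eLpNorm_mul_rpow_measure_univ hq.le hfA.1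
  rw [Measure.restrict_apply_univ, hfA.eLpNorm_eq_integral_rpow_norm two_ne_zero (by simp)] at h1
  have h2 : eLpNorm f q (π.restrict A) * π A ^ (1 / (2 : ℝ≥0∞).toReal - 1 / q.toReal)
      ≤ ENNReal.ofReal (B * π.real A ^ e) := by
    rw [ENNReal.ofReal_mul hB, ← ENNReal.ofReal_rpow_of_nonneg measureReal_nonneg he0,
      ofReal_measureReal]
    have : eLpNorm f q (π.restrict A) ≤ ENNReal.ofReal B :=
      (eLpNorm_mono_measure f Measure.restrict_le_self).trans hfB
    simpa [he] using mul_le_mul_left this _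
  have h3 := h1.trans h2
  rw [ENNReal.ofReal_le_ofReal_iff (by positivity)] at h3
  simp only [ENNReal.toReal_ofNat, Real.norm_eq_abs, Real.rpow_two, sq_abs] at h3
  have hI : 0 ≤ ∫ ω in A, f ω ^ 2 ∂π := integral_nonneg fun _ => sq_nonneg _
  calc ∫ ω in A, f ω ^ 2 ∂π = ((∫ ω in A, f ω ^ 2 ∂π) ^ (2 : ℝ)⁻¹) ^ 2 := by
        rw [← Real.rpow_natCast, ← Real.rpow_mul hI]; simp
    _ ≤ (B * π.real A ^ e) ^ 2 := by gcongr
    _ = B ^ 2 * π.real A ^ (2 * e) := by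
        rw [mul_pow, mul_comm 2 e, Real.rpow_mul measureReal_nonneg, Real.rpow_two]
    _ ≤ B ^ 2 * (η ^ tailExponent q) ^ (2 * e) := by gcongr
    _ = B ^ 2 * η := by rw [← Real.rpow_mul hη, hte, Real.rpow_one]

theorem integral_sq_le_of_eLpNorm_le [IsProbabilityMeasure π] {f : Ω → ℝ} (hf : MemLp f 2 π)
    {q : ℝ≥0∞} (hq : 2 < q) {B : ℝ} (hB : 0 ≤ B) (hfB : eLpNorm f q π ≤ ENNReal.ofReal B) :
    ∫ ω, f ω ^ 2 ∂π ≤ B ^ 2 := by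
  simpa using setIntegral_sq_le hf hq hB hfB (A := Set.univ) (η := 1) zero_le_one (by simp)

/-- The restricted variance of a density that is bounded in `L^q` is close to its variance. -/
theorem sub_le_restrictedVar [IsProbabilityMeasure π] {f : Ω → ℝ} (hf : MemLp f 2 π)
    (hnn : ∀ ω, 0 ≤ f ω) (hf1 : ∫ ω, f ω ∂π = 1) {q : ℝ≥0∞}
    (hq : 2 < q) {B : ℝ} (hB : 0 ≤ B) (hfB : eLpNorm f q π ≤ ENNReal.ofReal B) {s : Set Ω}
    (hs : MeasurableSet s) {η : ℝ} (hη : 0 ≤ η) (hη1 : η ≤ 1)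
    (hsη : 1 - η ^ tailExponent q ≤ π.real s) :
    ∫ ω, f ω ^ 2 ∂π - 1 - 2 * B ^ 2 * η
      ≤ π.real s * ∫ ω in s, f ω ^ 2 ∂π - (∫ ω in s, f ω ∂π) ^ 2 := by
  have hfi : Integrable f π := hf.integrable one_le_two
  have hc : π.real sᶜ = 1 - π.real s := probReal_compl_eq_one_sub hs
  have h1 := setIntegral_sq_le hf hq hB hfB hη (A := sᶜ) (by linarith)
  have h2 : ∫ ω in s, f ω ∂π ≤ 1 := hf1 ▸ setIntegral_le_integral hfi (ae_of_all _ hnn)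
  have h3 : 0 ≤ ∫ ω in s, f ω ∂π := integral_nonneg hnn
  have h4 := integral_add_compl hs hf.integrable_sq
  have h5 : ∫ ω in s, f ω ^ 2 ∂π ≤ B ^ 2 :=
    (setIntegral_le_integral hf.integrable_sq (ae_of_all _ fun _ => sq_nonneg _)).trans
      (integral_sq_le_of_eLpNorm_le hf hq hB hfB)
  have h6 : 0 ≤ ∫ ω in s, f ω ^ 2 ∂π := integral_nonneg fun _ => sq_nonneg _
  -- Since the exponent is at least 1 and η ≤ 1, the mass missing from s is itself at most η.
  have h7 : η ^ tailExponent q ≤ η := by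
    rcases hη.eq_or_lt with rfl | hη0
    · rw [Real.zero_rpow (zero_lt_one.trans_le (one_le_tailExponent hq)).ne']
    · simpa using Real.rpow_le_rpow_of_exponent_ge hη0 hη1 (one_le_tailExponent hq)
  have h8 : (1 - π.real s) * ∫ ω in s, f ω ^ 2 ∂π ≤ η * B ^ 2 :=
    mul_le_mul (by linarith) h5 h6 hη
  -- Besides (∫_s f)² ≤ 1, passing from ∫f² to π(s)∫_s f² loses ∫ f² over the complement and (1 −
  -- π(s))∫_s f², each at most B²η.
  nlinarith

/-- Above the level a the excess contracts by 1 − c ≤ exp(−c); at or below it, V does not increase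
and so never rises past a. Tracking the positive part covers both cases. -/
theorem sub_le_exp_mul_of_recurrence {V : ℕ → ℝ} {a c : ℝ}
    (h : ∀ n, V (n + 1) ≤ V n - c * max (V n - a) 0) (n : ℕ) :
    V n - a ≤ Real.exp (-(c * n)) * max (V 0 - a) 0 := by
  suffices hmax : max (V n - a) 0 ≤ Real.exp (-(c * n)) * max (V 0 - a) 0 from
    (le_max_left _ _).trans hmax
  induction n with
  | zero => simp
  | succ n ih =>
    have he : Real.exp (-(c * ((n + 1 : ℕ) : ℝ))) = Real.exp (-c) * Real.exp (-(c * n)) := by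
      rw [← Real.exp_add]; push_cast; ring_nf
    have hexp : 1 - c ≤ Real.exp (-c) := by linarith [Real.add_one_le_exp (-c)]
    have hW : 0 ≤ max (V n - a) 0 := le_max_right _ _
    have hstep : max (V (n + 1) - a) 0 ≤ Real.exp (-c) * max (V n - a) 0 := by
      refine max_le ?_ (by positivity)
      rcases le_total (V n - a) 0 with h0 | h0
      · have := h n
        rw [max_eq_right h0] at this ⊢
        linarith
      · have := h n
        rw [max_eq_left h0] at this ⊢
        nlinarith
    rw [he, mul_assoc]
    exact hstep.trans (by gcongr)

/-- Exponential decay, up to a tolerance, of the variance of the densities of a lazy chain with a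
restricted spectral gap on a set of nearly full mass. -/
theorem integral_sq_sub_one_le [IsMarkovKernel K] [IsProbabilityMeasure π]
    (hinv : K.Invariant π) (hlazy : IsLazyKernel K) {s : Set Ω} (hs : MeasurableSet s)
    {c : ℝ} (hc : 0 ≤ c) (hgap : ENNReal.ofReal c ≤ restrictedSpecGap K π s)
    {q : ℝ≥0∞} (hq : 2 < q) {B : ℝ} (hB : 1 ≤ B) {η : ℝ} (hη : 0 ≤ η) (hη1 : η ≤ 1)
    (hsη : 1 - η ^ tailExponent q ≤ π.real s)
    {f : ℕ → Ω → ℝ} (hfm : ∀ n, Measurable (f n)) (hnn : ∀ n ω, 0 ≤ f n ω)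
    (hsucc : ∀ n, f (n + 1) = markovOp K (f n)) (hf1 : ∫ ω, f 0 ω ∂π = 1)
    (hf : MemLp (f 0) 2 π) (hfB : eLpNorm (f 0) q π ≤ ENNReal.ofReal B) (n : ℕ) :
    MemLp (f n) 2 π ∧ ∫ ω, f n ω ∂π = 1 ∧
      ∫ ω, f n ω ^ 2 ∂π - 1 ≤ 2 * B ^ 2 * η + Real.exp (-(c * n)) * B ^ 2 := by
  have hB0 : 0 ≤ B := by linarith
  have hall : ∀ n, MemLp (f n) 2 π ∧ ∫ ω, f n ω ∂π = 1
      ∧ eLpNorm (f n) q π ≤ ENNReal.ofReal B := by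
    intro n
    induction n with
    | zero => exact ⟨hf, hf1, hfB⟩
    | succ n ih =>
      rw [hsucc]
      exact ⟨memLp_markovOp hinv (hfm n) one_le_two ih.1,
        (integral_markovOp hinv (ih.1.integrable one_le_two)).trans ih.2.1,
        (eLpNorm_markovOp_le hinv (hfm n) (one_le_two.trans hq.le)).trans ih.2.2⟩
  refine ⟨(hall n).1, (hall n).2.1, ?_⟩
  have hrec : ∀ n, ∫ ω, f (n + 1) ω ^ 2 ∂π - 1 ≤ (∫ ω, f n ω ^ 2 ∂π - 1)
      - c * max ((∫ ω, f n ω ^ 2 ∂π - 1) - 2 * B ^ 2 * η) 0 := by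
    intro n
    obtain ⟨h2, h1, hqn⟩ := hall n
    have h := integral_markovOp_sq_le_sub hinv hlazy hc hgap (hfm n) h2
    have hv := sub_le_restrictedVar h2 (hnn n) h1 hq hB0 hqn hs hη hη1 hsη
    have := mul_le_mul_of_nonneg_left (max_le_max_right 0 hv) hc
    rw [hsucc]
    linarith
  have h := sub_le_exp_mul_of_recurrence (V := fun n => ∫ ω, f n ω ^ 2 ∂π - 1) hrec n
  have h0 : max (∫ ω, f 0 ω ^ 2 ∂π - 1 - 2 * B ^ 2 * η) 0 ≤ B ^ 2 := by
    refine max_le ?_ (by positivity)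
    have := integral_sq_le_of_eLpNorm_le hf hq hB0 hfB
    have : 0 ≤ 2 * B ^ 2 * η := by positivity
    linarith
  have := mul_le_mul_of_nonneg_left h0 (Real.exp_nonneg (-(c * n)))
  linarith

/-- Cauchy–Schwarz, as nonnegativity of the variance of |f − 1|, together with ∫(f − 1)² = ∫f² − 1.
-/
theorem integral_abs_sub_one_sq_le [IsProbabilityMeasure π] {f : Ω → ℝ} (hf : MemLp f 2 π)
    (hf1 : ∫ ω, f ω ∂π = 1) :
    (∫ ω, |f ω - 1| ∂π) ^ 2 ≤ ∫ ω, f ω ^ 2 ∂π - 1 := by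
  have hg : MemLp (fun ω => |f ω - 1|) 2 π := (hf.sub (memLp_const 1)).abs
  have h := integral_sub_const_sq hg (∫ ω, |f ω - 1| ∂π)
  have h0 : 0 ≤ ∫ ω, (|f ω - 1| - ∫ ω, |f ω - 1| ∂π) ^ 2 ∂π := integral_nonneg fun _ => sq_nonneg _
  have h1 := integral_sub_const_sq hf 1
  simp only [sq_abs, probReal_univ, hf1] at h h1
  rw [h1] at h
  nlinarith

/-- With r = dπ/d(ν + π), the chain rule gives dν/d(ν + π) = f r; the integrand becomes r|f − 1|,
and r is absorbed by changing the measure back to π. -/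
theorem tvDist_withDensity [IsFiniteMeasure π] {f : Ω → ℝ} (hfm : Measurable f)
    (hnn : ∀ ω, 0 ≤ f ω) (hf : Integrable f π) :
    tvDist (π.withDensity fun ω => ENNReal.ofReal (f ω)) π = ∫ ω, |f ω - 1| ∂π := by
  set ν := π.withDensity fun ω => ENNReal.ofReal (f ω) with hν
  have hνfin : IsFiniteMeasure ν := by
    refine isFiniteMeasure_withDensity ?_
    rw [← ofReal_integral_eq_lintegral_ofReal hf (ae_of_all _ hnn)]
    exact ENNReal.ofReal_ne_top
  have hνπ : ν ≪ π := withDensity_absolutelyContinuous _ _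
  have hπ : π ≪ ν + π := Measure.absolutelyContinuous_of_le (Measure.le_add_left le_rfl)
  have hd : ν.rnDeriv π =ᵐ[π] fun ω => ENNReal.ofReal (f ω) :=
    Measure.rnDeriv_withDensity π hfm.ennreal_ofReal
  have hπ' : ν + π ≪ π := hνπ.add_left Measure.AbsolutelyContinuous.rfl
  rw [tvDist, ← integral_rnDeriv_smul hπ]
  refine integral_congr_ae ?_
  filter_upwards [Measure.rnDeriv_mul_rnDeriv hνπ (κ := ν + π), hπ'.ae_le hd] with ω h1 h2
  rw [← h1, Pi.mul_apply, h2, ENNReal.toReal_mul, ENNReal.toReal_ofReal (hnn ω), smul_eq_mul]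
  set r := (π.rnDeriv (ν + π) ω).toReal
  have hr : 0 ≤ r := ENNReal.toReal_nonneg
  rw [show f ω * r - r = r * (f ω - 1) by ring, abs_mul, abs_of_nonneg hr]

/-- A set's probability changes by at most half of the `L¹` distance of the density to `1`. -/
theorem two_mul_abs_setIntegral_sub_one_le [IsProbabilityMeasure π] {f : Ω → ℝ}
    (hf : Integrable f π) (hf1 : ∫ ω, f ω ∂π = 1) {A : Set Ω} (hA : MeasurableSet A) :
    2 * |∫ ω in A, (f ω - 1) ∂π| ≤ ∫ ω, |f ω - 1| ∂π := by
  have hi : Integrable (fun ω => f ω - 1) π := hf.sub (integrable_const 1)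
  have h0 : ∫ ω, (f ω - 1) ∂π = 0 := by
    rw [integral_sub hf (integrable_const 1), hf1]; simp
  have h1 := integral_add_compl hA hi
  have h2 := integral_add_compl hA hi.abs
  have h3 : |∫ ω in A, (f ω - 1) ∂π| ≤ ∫ ω in A, |f ω - 1| ∂π := abs_integral_le_integral_abs
  have h4 : |∫ ω in Aᶜ, (f ω - 1) ∂π| ≤ ∫ ω in Aᶜ, |f ω - 1| ∂π := abs_integral_le_integral_abs
  -- As f − 1 has total integral zero, A and its complement contribute opposite amounts; this saves
  -- the factor 2.
  have h5 : |∫ ω in Aᶜ, (f ω - 1) ∂π| = |∫ ω in A, (f ω - 1) ∂π| := by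
    rw [h0, add_comm] at h1
    rw [eq_neg_of_add_eq_zero_left h1, abs_neg]
  linarith

end VarianceDecay

/-- With a = ∫g, split g/a − 1 = (g − 1) + g(1/a − 1); the last term has L¹ norm |1 − a|. -/
theorem integral_abs_div_sub_one_le {α : Type*} [MeasurableSpace α] {ν : Measure α}
    [IsProbabilityMeasure ν] {g : α → ℝ} (hg : Integrable g ν) (hnn : ∀ x, 0 ≤ g x) :
    ∫ x, |g x / (∫ y, g y ∂ν) - 1| ∂ν ≤ ∫ x, |g x - 1| ∂ν + |∫ y, g y ∂ν - 1| := by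
  have ha : 0 ≤ ∫ y, g y ∂ν := integral_nonneg hnn
  set a := ∫ y, g y ∂ν with ha_def
  have h1 : 0 ≤ ∫ x, |g x - 1| ∂ν := integral_nonneg fun _ => abs_nonneg _
  -- If a = 0, division by zero makes the left side 1, and the term |0 − 1| on the right already
  -- covers it.
  rcases ha.eq_or_lt with h0 | h0
  · rw [← h0]
    simpa using h1
  · have hi1 : Integrable (fun x => |g x - 1|) ν := (hg.sub (integrable_const 1)).abs
    have hi2 : Integrable (fun x => g x * |a⁻¹ - 1|) ν := hg.mul_const _
    have hi3 : Integrable (fun x => |g x / a - 1|) ν :=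
      ((hg.div_const a).sub (integrable_const 1)).abs
    calc ∫ x, |g x / a - 1| ∂ν ≤ ∫ x, (|g x - 1| + g x * |a⁻¹ - 1|) ∂ν := by
          refine integral_mono hi3 (hi1.add hi2) fun x => ?_
          calc |g x / a - 1| = |(g x - 1) + g x * (a⁻¹ - 1)| := by congr 1; ring
            _ ≤ |g x - 1| + |g x * (a⁻¹ - 1)| := abs_add_le _ _
            _ = |g x - 1| + g x * |a⁻¹ - 1| := by rw [abs_mul, abs_of_nonneg (hnn x)]
      _ = ∫ x, |g x - 1| ∂ν + a * |a⁻¹ - 1| := by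
          rw [integral_add hi1 hi2, integral_mul_const]
      _ = ∫ x, |g x - 1| ∂ν + |a - 1| := by
          congr 1
          rw [← abs_of_pos h0, ← abs_mul, abs_of_pos h0, mul_sub, mul_inv_cancel₀ h0.ne', mul_one,
            abs_sub_comm]

/-! ### The tempering kernel and the conditional laws at the levels. -/

namespace SimulatedTempering

variable {L : ℕ} {X : Type*} [MeasurableSpace X] {μ : Measure X}

theorem isProbabilityMeasure_levelLaw (S : SimulatedTempering L μ) (i : Fin L) :
    IsProbabilityMeasure (S.levelLaw i) :=
  ⟨by rw [levelLaw, withDensity_apply _ MeasurableSet.univ, Measure.restrict_univ,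
    S.p_lintegral i]⟩

theorem isProbabilityMeasure_law (S : SimulatedTempering L μ) : IsProbabilityMeasure S.law := by
  refine ⟨?_⟩
  have := S.isProbabilityMeasure_levelLaw
  simp only [law, Measure.finsetSum_apply, Measure.smul_apply, smul_eq_mul,
    Measure.map_apply measurable_prodMk_left MeasurableSet.univ, Set.preimage_univ, measure_univ,
    mul_one]
  rw [← ENNReal.ofReal_sum_of_nonneg fun i _ => (S.r_pos i).le, S.r_sum, ENNReal.ofReal_one]

theorem swapProb_nonneg (S : SimulatedTempering L μ) (i i' : Fin L) (x : X) :
    0 ≤ S.swapProb i i' x := by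
  unfold swapProb accept
  have := S.lam_pos
  split_ifs
  · positivity
  · have h1 := mul_nonneg (S.r_pos i).le (S.p_nonneg i x)
    have h2 := mul_nonneg (S.r_pos i').le (S.p_nonneg i' x)
    positivity
  · exact le_rfl

/-- A level has at most two neighbours, each reached with probability at most λ/2. Hence the holding
weight in `kernel` is not truncated by `ENNReal.ofReal`, and the total mass is 1. -/
theorem sum_swapProb_le (S : SimulatedTempering L μ) (i : Fin L) (x : X) :
    ∑ i', S.swapProb i i' x ≤ S.lam := by
  have hlam := S.lam_pos
  have hacc : ∀ i', S.accept i i' x ≤ 1 := by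
    intro i'
    unfold accept
    split_ifs
    · exact le_rfl
    · exact min_le_right _ _
  have hone : ∀ (k : Fin L → ℕ) (m : ℕ), Function.Injective k →
      ∑ i', (if k i' = m then S.lam / 2 else 0) ≤ S.lam / 2 := by
    intro k m hk
    rw [← Finset.sum_filter, Finset.sum_const, nsmul_eq_mul]
    have hcard : (Finset.univ.filter fun i' => k i' = m).card ≤ 1 :=
      Finset.card_le_one.2 fun a ha b hb =>
        hk ((Finset.mem_filter.1 ha).2.trans (Finset.mem_filter.1 hb).2.symm)
    have : ((Finset.univ.filter fun i' => k i' = m).card : ℝ) ≤ 1 := by exact_mod_cast hcard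
    nlinarith
  calc ∑ i', S.swapProb i i' x
      ≤ ∑ i' : Fin L, ((if (i' : ℕ) = i + 1 then S.lam / 2 else 0)
          + if (i' : ℕ) + 1 = i then S.lam / 2 else 0) := by
        refine Finset.sum_le_sum fun i' _ => ?_
        have := hacc i'
        unfold swapProb
        split_ifs <;> first | omega | nlinarith
    _ ≤ S.lam / 2 + S.lam / 2 := by
        rw [Finset.sum_add_distrib]
        exact add_le_add (hone _ _ Fin.val_injective)
          (hone (fun i' => (i' : ℕ) + 1) _ fun a b h => Fin.ext (Nat.succ_injective h))
    _ = S.lam := by ring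

theorem isMarkovKernel_kernel (S : SimulatedTempering L μ) : IsMarkovKernel S.kernel := by
  refine ⟨fun ω => ⟨?_⟩⟩
  have := S.K_markov ω.1
  have hsum := S.sum_swapProb_le ω.1 ω.2
  have hnn : 0 ≤ ∑ i', S.swapProb ω.1 i' ω.2 :=
    Finset.sum_nonneg fun i' _ => S.swapProb_nonneg _ _ _
  change (ENNReal.ofReal (1 - S.lam) • (S.K ω.1 ω.2).map (Prod.mk ω.1)
      + ∑ i', ENNReal.ofReal (S.swapProb ω.1 i' ω.2) • Measure.dirac (i', ω.2)
      + ENNReal.ofReal (S.lam - ∑ i', S.swapProb ω.1 i' ω.2) • Measure.dirac ω) Set.univ = 1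
  simp only [Measure.add_apply, Measure.smul_apply, Measure.finsetSum_apply, smul_eq_mul,
    Measure.map_apply measurable_prodMk_left MeasurableSet.univ, Set.preimage_univ, measure_univ,
    mul_one]
  rw [← ENNReal.ofReal_sum_of_nonneg fun i' _ => S.swapProb_nonneg _ _ _,
    ← ENNReal.ofReal_add (by linarith [S.lam_lt_one]) hnn,
    ← ENNReal.ofReal_add (by linarith [S.lam_lt_one]) (by linarith)]
  simp

theorem measurableSet_level (i : Fin L) : MeasurableSet (Prod.fst ⁻¹' {i} : Set (Fin L × X)) :=
  measurable_fst (measurableSet_singleton i)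

theorem law_restrict_level (S : SimulatedTempering L μ) (i : Fin L) :
    S.law.restrict (Prod.fst ⁻¹' {i})
      = ENNReal.ofReal (S.r i) • (S.levelLaw i).map (Prod.mk i) := by
  ext A hA
  rw [Measure.restrict_apply hA, law, Measure.finsetSum_apply, Finset.sum_eq_single i]
  · rw [Measure.smul_apply, Measure.smul_apply, Measure.map_apply measurable_prodMk_left hA,
      Measure.map_apply measurable_prodMk_left (hA.inter (measurableSet_level i))]
    congr 2
    ext x
    simp
  · intro j _ hj
    rw [Measure.smul_apply,
      Measure.map_apply measurable_prodMk_left (hA.inter (measurableSet_level i))]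
    have : Prod.mk j ⁻¹' (A ∩ Prod.fst ⁻¹' {i}) = (∅ : Set X) := by
      ext x
      simp [hj]
    simp [this]
  · simp

theorem setIntegral_level (S : SimulatedTempering L μ) (i : Fin L) {g : Fin L × X → ℝ}
    (hg : Measurable g) :
    ∫ ω in Prod.fst ⁻¹' {i}, g ω ∂S.law = S.r i * ∫ x, g (i, x) ∂(S.levelLaw i) := by
  rw [law_restrict_level, integral_smul_measure,
    integral_map measurable_prodMk_left.aemeasurable hg.aestronglyMeasurable,
    ENNReal.toReal_ofReal (S.r_pos i).le, smul_eq_mul]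

theorem integrable_level (S : SimulatedTempering L μ) (i : Fin L) {g : Fin L × X → ℝ}
    (hgm : Measurable g) (hg : Integrable g S.law) :
    Integrable (fun x => g (i, x)) (S.levelLaw i) := by
  have h := hg.restrict (s := Prod.fst ⁻¹' {i})
  rw [law_restrict_level, integrable_smul_measure (by simpa using S.r_pos i) (by simp),
    integrable_map_measure hgm.aestronglyMeasurable measurable_prodMk_left.aemeasurable] at h
  exact h

/-- The conditional law at a level of a law with density `f`. -/
theorem condLevel_withDensity (S : SimulatedTempering L μ) (i : Fin L) {f : Fin L × X → ℝ}
    (hfm : Measurable f) (hnn : ∀ ω, 0 ≤ f ω) (hf : Integrable f S.law) :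
    condLevel (S.law.withDensity fun ω => ENNReal.ofReal (f ω)) i
      = (S.levelLaw i).withDensity
        fun x => ENNReal.ofReal (f (i, x) / ∫ y, f (i, y) ∂(S.levelLaw i)) := by
  have hg := S.integrable_level i hfm hf
  have hgm : Measurable fun x => f (i, x) := hfm.comp measurable_prodMk_left
  set a := ∫ y, f (i, y) ∂(S.levelLaw i) with ha_def
  have ha : 0 ≤ a := integral_nonneg fun x => hnn (i, x)
  have hr0 : ENNReal.ofReal (S.r i) ≠ 0 := by simpa using S.r_pos i
  have hlev : ∀ A : Set X, MeasurableSet A →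
      (S.law.withDensity fun ω => ENNReal.ofReal (f ω)) (Prod.fst ⁻¹' {i} ∩ Prod.snd ⁻¹' A)
        = ENNReal.ofReal (S.r i) * ∫⁻ x in A, ENNReal.ofReal (f (i, x)) ∂(S.levelLaw i) := by
    intro A hA
    have hA' : MeasurableSet (Prod.snd ⁻¹' A : Set (Fin L × X)) := measurable_snd hA
    rw [withDensity_apply _ ((measurableSet_level i).inter hA'), Set.inter_comm,
      ← Measure.restrict_restrict hA', law_restrict_level, Measure.restrict_smul,
      lintegral_smul_measure, setLIntegral_map hA' hfm.ennreal_ofReal measurable_prodMk_left]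
    rfl
  have hI : ∫⁻ x, ENNReal.ofReal (f (i, x)) ∂(S.levelLaw i) = ENNReal.ofReal a :=
    (ofReal_integral_eq_lintegral_ofReal hg (ae_of_all _ fun x => hnn (i, x))).symm
  have hmass := hlev Set.univ MeasurableSet.univ
  rw [Set.preimage_univ, Set.inter_univ, Measure.restrict_univ, hI] at hmass
  ext A hA
  rw [condLevel, Measure.map_apply measurable_snd hA, cond_apply (measurableSet_level i),
    hlev A hA, hmass, withDensity_apply _ hA]
  -- For a level of zero mass both sides are the zero measure: on the left the integral over A
  -- vanishes, on the right the density is a division by zero.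
  rcases ha.eq_or_lt with h0 | h0
  · have hz : ∫⁻ x in A, ENNReal.ofReal (f (i, x)) ∂(S.levelLaw i) = 0 := by
      refine le_antisymm ((setLIntegral_le_lintegral _ _).trans ?_) zero_le
      rw [hI, ← h0, ENNReal.ofReal_zero]
    simp [hz, ← h0]
  · simp only [ENNReal.ofReal_div_of_pos h0]
    simp only [div_eq_mul_inv]
    rw [lintegral_mul_const _ hgm.ennreal_ofReal,
      ENNReal.mul_inv (Or.inl hr0) (Or.inl ENNReal.ofReal_ne_top), mul_mul_mul_comm,
      ENNReal.inv_mul_cancel hr0 ENNReal.ofReal_ne_top, one_mul, mul_comm]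

/-- The conditional laws at the levels are close if the joint laws are. -/
theorem tvDist_condLevel_le (S : SimulatedTempering L μ) (i : Fin L) {f : Fin L × X → ℝ}
    (hfm : Measurable f) (hnn : ∀ ω, 0 ≤ f ω) (hf : Integrable f S.law)
    (hf1 : ∫ ω, f ω ∂S.law = 1) :
    tvDist (condLevel (S.law.withDensity fun ω => ENNReal.ofReal (f ω)) i) (S.levelLaw i)
      ≤ 3 * (∫ ω, |f ω - 1| ∂S.law) / (2 * S.r i) := by
  have := S.isProbabilityMeasure_law
  have := S.isProbabilityMeasure_levelLaw i
  have hr := S.r_pos i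
  have hg := S.integrable_level i hfm hf
  have hgm : Measurable fun x => f (i, x) := hfm.comp measurable_prodMk_left
  have ha : 0 ≤ ∫ y, f (i, y) ∂(S.levelLaw i) := integral_nonneg fun x => hnn (i, x)
  rw [S.condLevel_withDensity i hfm hnn hf, tvDist_withDensity (hgm.div_const _)
    (fun x => div_nonneg (hnn _) ha) (hg.div_const _)]
  have h1 := integral_abs_div_sub_one_le hg fun x => hnn (i, x)
  have h2 := two_mul_abs_setIntegral_sub_one_le hf hf1 (measurableSet_level i)
  rw [S.setIntegral_level i (hfm.sub_const 1), abs_mul, abs_of_pos hr,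
    integral_sub hg (integrable_const 1)] at h2
  have hi : Integrable (fun ω => |f ω - 1|) S.law := (hf.sub (integrable_const 1)).abs
  have h3 := setIntegral_le_integral (s := Prod.fst ⁻¹' {i}) hi
    (ae_of_all _ fun _ => abs_nonneg _)
  rw [S.setIntegral_level i (hfm.sub_const 1).abs] at h3
  simp only [integral_const, probReal_univ, smul_eq_mul, mul_one] at h2
  rw [le_div_iff₀ (by positivity)]
  -- After multiplication by r_i, the L¹ term is at most D = ∫|f − 1| and the mass error at most
  -- D/2, for a total of 3D/2.
  nlinarith

end SimulatedTempering

/-! ### Assembly of the mixing bounds. -/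

theorem mainTheorem3 {L : ℕ} {X : Type*} [MeasurableSpace X] {μ : Measure X}
    (S : SimulatedTempering L μ)
    (hrev : S.kernel.IsReversible S.law)
    (hlazy : IsLazyKernel S.kernel)
    (P0 : Measure (Fin L × X)) [IsProbabilityMeasure P0] (hP0 : P0 ≪ S.law)
    (ε : ℝ) (hε : 0 < ε) (hε1 : ε < 1)
    (B : ℝ) (hB : 1 < B) (q : ℝ≥0∞) (hq : 2 < q)
    (X0 : Set X) (hX0 : MeasurableSet X0)
    (hf0 : eLpNorm (fun ω => (P0.rnDeriv S.law ω).toReal) q S.law ≤ ENNReal.ofReal B)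
    (hmass : 1 - (ε ^ 2 / (20 * B ^ 2)) ^ tailExponent q
      ≤ S.law.real ((Set.univ : Set (Fin L)) ×ˢ X0))
    (CM : ℝ) (hCM : 0 < CM)
    (hgap : ENNReal.ofReal CM⁻¹
      ≤ restrictedSpecGap S.kernel S.law ((Set.univ : Set (Fin L)) ×ˢ X0))
    (N : ℕ) (hN : CM * Real.log (2 * B ^ 2 / ε ^ 2) ≤ N) :
    tvDist (lawAfter S.kernel P0 N) S.law ≤ ε ∧
      ∀ i : Fin L, tvDist (condLevel (lawAfter S.kernel P0 N) i) (S.levelLaw i)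
        ≤ 3 * ε / (2 * ⨅ k, S.r k) := by
  have := S.isProbabilityMeasure_law
  have := S.isMarkovKernel_kernel
  have hinv := hrev.invariant
  set f : ℕ → Fin L × X → ℝ :=
    fun n => (markovOp S.kernel)^[n] fun ω => (P0.rnDeriv S.law ω).toReal with hf_def
  have hsucc : ∀ n, f (n + 1) = markovOp S.kernel (f n) := fun n =>
    Function.iterate_succ_apply' _ _ _
  have hfm : ∀ n, Measurable (f n) := by
    intro n
    induction n with
    | zero => exact (Measure.measurable_rnDeriv _ _).ennreal_toReal
    | succ n ih => rw [hsucc]; exact measurable_markovOp ih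
  have hnn : ∀ n ω, 0 ≤ f n ω := by
    intro n
    induction n with
    | zero => exact fun ω => ENNReal.toReal_nonneg
    | succ n ih => rw [hsucc]; exact markovOp_nonneg ih
  have hf1 : ∫ ω, f 0 ω ∂S.law = 1 :=
    (Measure.integral_toReal_rnDeriv hP0).trans (by simp)
  have hmem : MemLp (f 0) 2 S.law := by
    have hmq : MemLp (f 0) q S.law :=
      ⟨(hfm 0).aestronglyMeasurable, hf0.trans_lt ENNReal.ofReal_lt_top⟩
    exact hmq.mono_exponent hq.le
  have hB0 : 0 < B := by linarith
  have hη1 : ε ^ 2 / (20 * B ^ 2) ≤ 1 := by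
    rw [div_le_one (by positivity)]
    nlinarith
  have hdecay := integral_sq_sub_one_le hinv hlazy (MeasurableSet.univ.prod hX0)
    (inv_nonneg.2 hCM.le) hgap hq hB.le (by positivity) hη1 hmass hfm hnn hsucc hf1 hmem hf0
  have hint : ∀ n, Integrable (f n) S.law := fun n => (hdecay n).1.integrable one_le_two
  have hlaw : lawAfter S.kernel P0 N = S.law.withDensity fun ω => ENNReal.ofReal (f N ω) := by
    rw [← lawAfter_withDensity hrev hfm hnn hint hsucc N]
    congr 1
    conv_lhs => rw [← Measure.withDensity_rnDeriv_eq P0 S.law hP0]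
    refine withDensity_congr_ae ?_
    filter_upwards [Measure.rnDeriv_lt_top P0 S.law] with ω hω
    exact (ENNReal.ofReal_toReal hω.ne).symm
  obtain ⟨hN2, hN1, hNd⟩ := hdecay N
  have hexp : Real.exp (-(CM⁻¹ * N)) * B ^ 2 ≤ ε ^ 2 / 2 := by
    have h1 : Real.log (2 * B ^ 2 / ε ^ 2) ≤ CM⁻¹ * N := by
      rw [inv_mul_eq_div, le_div_iff₀ hCM, mul_comm]
      exact hN
    have h2 : Real.exp (-(CM⁻¹ * N)) ≤ ε ^ 2 / (2 * B ^ 2) := by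
      calc Real.exp (-(CM⁻¹ * N)) ≤ Real.exp (-Real.log (2 * B ^ 2 / ε ^ 2)) :=
            Real.exp_le_exp.2 (neg_le_neg h1)
        _ = ε ^ 2 / (2 * B ^ 2) := by
            rw [Real.exp_neg, Real.exp_log (by positivity), inv_div]
    calc Real.exp (-(CM⁻¹ * N)) * B ^ 2 ≤ ε ^ 2 / (2 * B ^ 2) * B ^ 2 := by gcongr
      _ = ε ^ 2 / 2 := by field_simp
  -- The constant 20 makes the tolerance ε²/10; with the ε²/2 from the exponential term the variance
  -- stays below ε².
  have hη : 2 * B ^ 2 * (ε ^ 2 / (20 * B ^ 2)) = ε ^ 2 / 10 := by field_simp; norm_num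
  have hD : ∫ ω, |f N ω - 1| ∂S.law ≤ ε := by
    have h := integral_abs_sub_one_sq_le hN2 hN1
    refine abs_le_of_sq_le_sq' ?_ hε.le |>.2
    nlinarith [sq_nonneg ε]
  rw [hlaw]
  refine ⟨(tvDist_withDensity (hfm N) (hnn N) (hint N)).trans_le hD, fun i => ?_⟩
  refine (S.tvDist_condLevel_le i (hfm N) (hnn N) (hint N) hN1).trans ?_
  have : Nonempty (Fin L) := ⟨i⟩
  have hmin : 0 < ⨅ k, S.r k := by
    obtain ⟨k, hk⟩ := exists_eq_ciInf_of_finite (f := S.r)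
    rw [← hk]
    exact S.r_pos k
  have hle : ⨅ k, S.r k ≤ S.r i := ciInf_le (Set.finite_range _).bddBelow i
  gcongr
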